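/- Let $N\ge 1$, $1\le p<\infty$, and let $\Omega\subset\mathbb R^N$ be a bounded domain (open connected set) with $C^1$ boundary, i.e. near each boundary point, in suitable orthonormal coordinates, $\Omega$ is the region above the graph of a $C^1$ function. Let $Q=[0,1]^N$ and let $g\in L^\infty(\mathbb R^N)$ be a real-valued $Q$-periodic function, that is, $g(x+e_i)=g(x)$ for a.e. $x\in\mathbb R^N$ and every standard basis vector $e_i$. Put $\bar g=\int_Q g\,dx$. Then there is a constant $c$, depending only on $N,p,\Omega,g$, such that for every $\varepsilon>0$ and every real-valued $u\in W^{1,p}(\Omega)$ the function $x\mapsto (g(x/\varepsilon)-\bar g)\,u(x)$ is integrable on $\Omega$ and $$\left|\int_\Omega \big(g(\tfrac{x}{\varepsilon})-\bar g\big)\,u\,dx\right|\le c\,\varepsilon\,\|u\|_{W^{1,p}(\Omega)},\qquad \|u\|_{W^{1,p}(\Omega)}=\Big(\int_\Omega|u|^p\,dx+\int_\Omega|\nabla u|^p\,dx\Big)^{1/p}.$$ -/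

import Mathlib

open MeasureTheory
open scoped ENNReal ContDiff RealInnerProductSpace

noncomputable section

namespace PeriodicHomogenization

/-- The space `ℝ^N` with its Euclidean norm and Lebesgue measure. -/
abbrev E (N : ℕ) : Type := EuclideanSpace ℝ (Fin N)

/-- The closed unit cube `Q = [0,1]^N`. -/
def unitCube (N : ℕ) : Set (E N) := {x | ∀ i, x i ∈ Set.Icc (0 : ℝ) 1}

/-- The average `∫_Q g` of `g` over the unit cube (which has measure one). -/
def cubeMean {N : ℕ} (g : E N → ℝ) : ℝ := ∫ y in unitCube N, g y

/-- `Q`-periodicity, for a function that matters only up to null sets: `g (x + e_i) = g x`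
for every standard basis vector `e_i` and almost every `x`. -/
def IsCubePeriodic {N : ℕ} (g : E N → ℝ) : Prop :=
  ∀ i : Fin N, ∀ᵐ x : E N, g (x + EuclideanSpace.single i 1) = g x

/-- `Ω` has `C¹` boundary: near each boundary point `x₀`, and in suitable orthonormal coordinates
(the last axis being spanned by the unit vector `e`, the other coordinates of `x` being those of
`x - ⟪e, x⟫ e`, the orthogonal projection of `x` to the hyperplane `e^⊥`), `Ω` is the region above
the graph of a `C¹` function `γ`. Only the values of `γ` on `e^⊥` are used; a `C¹` function on
that hyperplane extends to `ℝ^N` by composition with the projection. -/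
def HasC1Boundary {N : ℕ} (Ω : Set (E N)) : Prop :=
  ∀ x₀ ∈ frontier Ω, ∃ r : ℝ, 0 < r ∧ ∃ e : E N, ‖e‖ = 1 ∧ ∃ γ : E N → ℝ, ContDiff ℝ 1 γ ∧
    ∀ x ∈ Metric.ball x₀ r, (x ∈ Ω ↔ γ (x - ⟪e, x⟫ • e) < ⟪e, x⟫)

/-- `G` is a weak gradient of `u` in the open set `Ω`:
`∫_Ω u ∂_i φ = - ∫_Ω G_i φ` for all `φ ∈ C_c^∞(Ω)` and all `i`. -/
def HasWeakGradient {N : ℕ} (Ω : Set (E N)) (u : E N → ℝ) (G : E N → E N) : Prop :=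
  LocallyIntegrableOn u Ω ∧ LocallyIntegrableOn G Ω ∧
    ∀ φ : E N → ℝ, ContDiff ℝ ∞ φ → HasCompactSupport φ → tsupport φ ⊆ Ω → ∀ i : Fin N,
      ∫ x in Ω, u x * fderiv ℝ φ x (EuclideanSpace.single i 1) = -∫ x in Ω, G x i * φ x

/-- Weak gradients in an open set are unique up to null sets. -/
theorem HasWeakGradient.ae_eq {N : ℕ} {Ω : Set (E N)} (hΩ : IsOpen Ω) {u : E N → ℝ}
    {G H : E N → E N} (hG : HasWeakGradient Ω u G) (hH : HasWeakGradient Ω u H) :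
    G =ᵐ[volume.restrict Ω] H := by
  have key : ∀ i : Fin N, ∀ᵐ x, x ∈ Ω → G x i - H x i = 0 := by
    intro i
    have coord : ∀ {K : E N → E N}, LocallyIntegrableOn K Ω →
        LocallyIntegrableOn (fun x => K x i) Ω := by
      intro K hK x hx
      obtain ⟨s, hs, hK⟩ := hK x hx
      exact ⟨s, hs, (EuclideanSpace.proj (𝕜 := ℝ) i).integrable_comp hK⟩
    refine hΩ.ae_eq_zero_of_integral_contDiff_smul_eq_zero
      ((coord hG.2.1).sub (coord hH.2.1)) ?_
    intro φ hφ hc hs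
    have int : ∀ {K : E N → E N}, LocallyIntegrableOn K Ω →
        Integrable (fun x => K x i * φ x) (volume.restrict Ω) := by
      intro K hK
      have h1 : IntegrableOn (fun x => K x i) (tsupport φ) :=
        (coord hK).integrableOn_compact_subset hs hc
      have h2 : IntegrableOn (fun x => K x i * φ x) (tsupport φ) :=
        h1.mul_continuousOn hφ.continuous.continuousOn hc
      refine IntegrableOn.integrable (Integrable.integrableOn ?_)
      refine (integrableOn_iff_integrable_of_support_subset ?_).1 h2
      intro x hx
      apply subset_tsupport φ
      intro h0
      exact hx (by simp [h0])
    have e1 := hG.2.2 φ hφ hc hs i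
    have e2 := hH.2.2 φ hφ hc hs i
    have e3 : ∫ x in Ω, (G x i * φ x - H x i * φ x) = 0 := by
      rw [integral_sub (int hG.2.1) (int hH.2.1)]
      linarith
    rw [← e3, ← integral_indicator hΩ.measurableSet]
    refine integral_congr_ae (Filter.Eventually.of_forall fun x => ?_)
    by_cases hx : x ∈ Ω
    · simp [hx]; ring
    · have : φ x = 0 := by
        by_contra h
        exact hx (hs (subset_tsupport φ h))
      simp [hx, this]
  have key' := ae_all_iff.2 key
  filter_upwards [(ae_restrict_iff' hΩ.measurableSet).2
    (key'.mono fun x hx hxΩ i => hx i hxΩ)] with x hx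
  ext i
  exact sub_eq_zero.1 (hx i)

/-- Membership in `W^{1,p}(Ω)`: `u ∈ L^p(Ω)` has a weak gradient in `L^p(Ω)`. -/
def MemW1p {N : ℕ} (Ω : Set (E N)) (p : ℝ) (u : E N → ℝ) : Prop :=
  MemLp u (ENNReal.ofReal p) (volume.restrict Ω) ∧
    ∃ G : E N → E N, HasWeakGradient Ω u G ∧ MemLp G (ENNReal.ofReal p) (volume.restrict Ω)

open Classical in
/-- The weak gradient `∇u` of `u` in `Ω` (unique up to null sets; zero if there is none). -/
def weakGradient {N : ℕ} (Ω : Set (E N)) (u : E N → ℝ) : E N → E N :=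
  if h : ∃ G, HasWeakGradient Ω u G then h.choose else 0

/-- The norm `‖u‖_{W^{1,p}(Ω)} = (∫_Ω |u|^p + ∫_Ω |∇u|^p)^{1/p}`. -/
def w1pNorm {N : ℕ} (Ω : Set (E N)) (p : ℝ) (u : E N → ℝ) : ℝ :=
  ((∫ x in Ω, |u x| ^ p) + ∫ x in Ω, ‖weakGradient Ω u x‖ ^ p) ^ (1 / p)

end PeriodicHomogenization

end

namespace PeriodicHomogenization

open Filter Topology Set Metric
open scoped Convolution Pointwise

/-! Extend `u` by zero to `u₀` on the whole space. The jump across the boundary costs no more than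
bounded variation: `∫ |u₀(x+y) - u₀(x)| dx ≤ C |y| (‖u‖₁ + ‖∇u‖₁)`. Given this, fix `z` in the cube.
Replacing `g(x/ε)` by `g(x/ε + z)` amounts, after a change of variables, to translating `u₀` by
`-εz`, so `∫ g(x/ε) u₀` changes by at most `sup |g| · C ε √N · (‖u‖₁ + ‖∇u‖₁)`. Averaging over `z`
turns `g(x/ε + z)` into the mean of `g`, by Fubini and periodicity
(`IsCubePeriodic.abs_integral_sub_mean_mul_le`). Hölder on the bounded set `Ω` passes from `L¹` to
`L^p`.

The translation bound (`HasC1Boundary.exists_translate_le`) needs neither traces nor density of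
smooth functions. As long as the segments stay in `Ω`, it follows by duality with test functions.
Near the boundary, `Ω` is preserved by short translations in a cone of directions. A step `s v` in
the cone can enter `Ω` from outside but cannot leave it, and the points just entered form a thin
strip. About `t₀/s` further translates of the strip are disjoint and lie in `Ω`, so one of them
carries little mass; comparing the strip with its translates bounds its mass by `O(s)`. Any small
`y` is a difference of two cone steps, and compactness makes the bound global. -/

/-! ### Duality between the `L¹` norm and test functions. -/

lemma abs_div_abs_self_le_one (a : ℝ) : |(a / |a|)| ≤ 1 := by
  rw [abs_div, abs_abs]; exact div_self_le_one _

lemma mul_div_abs_self (a : ℝ) : a * (a / |a|) = |a| := by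
  rcases eq_or_ne a 0 with rfl | h
  · simp
  · rw [← mul_div_assoc, ← abs_mul_abs_self a, mul_div_assoc, div_self (abs_ne_zero.2 h), mul_one]

/-- Smooth approximation of a bounded function supported in a compact subset of an open set. -/
lemma exists_smooth_approx {N : ℕ} {K A : Set (E N)} (hK : IsCompact K) (hA : IsOpen A)
    (hKA : K ⊆ A) {σ : E N → ℝ} (hσ : Measurable σ) (hσ1 : ∀ x, |σ x| ≤ 1)
    (hσK : ∀ x, x ∉ K → σ x = 0) :
    ∃ ζ : ℕ → E N → ℝ, (∀ n, ContDiff ℝ ∞ (ζ n)) ∧ (∀ n, HasCompactSupport (ζ n)) ∧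
      (∀ n, tsupport (ζ n) ⊆ A) ∧ (∀ n x, |ζ n x| ≤ 1) ∧
      ∀ᵐ x, Tendsto (fun n => ζ n x) atTop (𝓝 (σ x)) := by
  obtain ⟨δ, hδ, hδA⟩ := hK.exists_cthickening_subset_open hA hKA
  -- Outer radii at most `δ` keep the supports in the `δ`-thickening of `K`. The ratio 2 of outer to
  -- inner radius is what a.e. convergence at Lebesgue points asks to be bounded.
  let φ : ℕ → ContDiffBump (0 : E N) := fun n =>
    ⟨δ / (n + 1) / 2, δ / (n + 1), by positivity, half_lt_self (by positivity)⟩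
  have hσi : LocallyIntegrable σ volume := by
    intro x
    refine ⟨ball x 1, ball_mem_nhds x one_pos, ?_⟩
    exact Measure.integrableOn_of_bounded (M := 1) measure_ball_lt_top.ne
      hσ.aestronglyMeasurable (Eventually.of_forall fun x => hσ1 x)
  have hsupp : ∀ n, Function.support
      ((φ n).normed volume ⋆[ContinuousLinearMap.lsmul ℝ ℝ, volume] σ) ⊆ cthickening δ K := by
    intro n x hx
    obtain ⟨a, ha, b, hb, rfl⟩ := support_convolution_subset _ hx
    rw [(φ n).support_normed_eq] at ha
    have hbK : b ∈ K := by
      by_contra h; exact hb (hσK b h)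
    refine mem_cthickening_of_dist_le _ b _ _ hbK ?_
    have h1 : ‖a‖ < δ / (n + 1) := by simpa [φ] using ha
    have h2 : δ / ((n : ℝ) + 1) ≤ δ := div_le_self hδ.le (by simp)
    simpa using h1.le.trans h2
  have hts : ∀ n, tsupport
      ((φ n).normed volume ⋆[ContinuousLinearMap.lsmul ℝ ℝ, volume] σ) ⊆ cthickening δ K :=
    fun n => closure_minimal (hsupp n) isClosed_cthickening
  refine ⟨fun n => (φ n).normed volume ⋆[ContinuousLinearMap.lsmul ℝ ℝ, volume] σ,
    fun n => ?_, fun n => ?_, fun n => (hts n).trans hδA, fun n x => ?_, ?_⟩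
  · exact (φ n).hasCompactSupport_normed.contDiff_convolution_left _ (φ n).contDiff_normed hσi
  · exact hK.cthickening.of_isClosed_subset (isClosed_tsupport _) (hts n)
  · have := dist_convolution_le (μ := (volume : Measure (E N))) (x₀ := x) (z₀ := (0 : ℝ))
      zero_le_one (φ n).support_normed_eq.subset (φ n).nonneg_normed
      ((φ n).integral_normed) (g := σ) hσ.aestronglyMeasurable (fun y _ => by simpa using hσ1 y)
    simpa using this
  · refine ContDiffBump.ae_convolution_tendsto_right_of_locallyIntegrable (K := 2) ?_ ?_ hσi
    · have := tendsto_one_div_add_atTop_nhds_zero_nat (𝕜 := ℝ)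
      simpa [φ, div_eq_mul_inv] using this.const_mul δ
    · refine Eventually.of_forall fun n => ?_
      simp only [φ]
      linarith

/-- The `L¹` norm on an open set is controlled by duality against test functions. -/
lemma lintegral_enorm_le_of_testFunctions {N : ℕ} {f : E N → ℝ} (hf : Integrable f)
    {A : Set (E N)} (hA : IsOpen A) {C : ℝ}
    (h : ∀ ζ : E N → ℝ, ContDiff ℝ ∞ ζ → HasCompactSupport ζ → tsupport ζ ⊆ A →
      (∀ x, |ζ x| ≤ 1) → |∫ x, f x * ζ x| ≤ C) :
    ∫⁻ x in A, ‖f x‖ₑ ≤ ENNReal.ofReal C := by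
  have key : ∀ K : Set (E N), K ⊆ A → IsCompact K → ∫⁻ x in K, ‖f x‖ₑ ≤ ENNReal.ofReal C := by
    intro K hKA hK
    set f' := hf.1.mk f with hf'
    have hm : Measurable f' := hf.1.stronglyMeasurable_mk.measurable
    have hae : f =ᵐ[volume] f' := hf.1.ae_eq_mk
    -- The sign of `f` on `K`; the convention `0 / 0 = 0` makes it vanish where `f` does.
    let σ : E N → ℝ := K.indicator fun x => f' x / |f' x|
    have hσm : Measurable σ := (hm.div hm.abs).indicator hK.measurableSet
    have hσ1 : ∀ x, |σ x| ≤ 1 := by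
      intro x
      by_cases hx : x ∈ K
      · simpa [σ, hx] using abs_div_abs_self_le_one (f' x)
      · simp [σ, hx]
    obtain ⟨ζ, h1, h2, h3, h4, h5⟩ := exists_smooth_approx hK hA hKA hσm hσ1
      (fun x hx => by simp [σ, hx])
    have hlim : Tendsto (fun n => ∫ x, f x * ζ n x) atTop (𝓝 (∫ x, f x * σ x)) := by
      refine tendsto_integral_of_dominated_convergence (fun x => |f x|) (fun n => ?_)
        hf.abs (fun n => Eventually.of_forall fun x => ?_) ?_
      · exact hf.1.mul (h1 n).continuous.aestronglyMeasurable
      · rw [Real.norm_eq_abs, abs_mul]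
        exact mul_le_of_le_one_right (abs_nonneg _) (h4 n x)
      · filter_upwards [h5] with x hx using hx.const_mul _
    have hle : |∫ x, f x * σ x| ≤ C :=
      le_of_tendsto hlim.abs (Eventually.of_forall fun n => h _ (h1 n) (h2 n) (h3 n) (h4 n))
    have heq : ∫ x, f x * σ x = ∫ x in K, ‖f x‖ := by
      rw [← integral_indicator hK.measurableSet]
      refine integral_congr_ae ?_
      filter_upwards [hae] with x hx
      by_cases hxK : x ∈ K
      · simp only [σ, indicator_of_mem hxK, hx, mul_div_abs_self, Real.norm_eq_abs]
      · simp [σ, hxK]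
    rw [← ofReal_integral_norm_eq_lintegral_enorm hf.integrableOn, ← heq]
    exact ENNReal.ofReal_le_ofReal ((le_abs_self _).trans hle)
  -- Inner regularity of the finite measure `|f| dx` passes from compact subsets to `A`.
  have hfin : IsFiniteMeasure (volume.withDensity fun x => ‖f x‖ₑ) :=
    isFiniteMeasure_withDensity hf.2.ne
  have hreg := hA.measure_eq_iSup_isCompact (volume.withDensity fun x => ‖f x‖ₑ)
  rw [withDensity_apply _ hA.measurableSet] at hreg
  rw [hreg]
  refine iSup_le fun K => iSup_le fun hKA => iSup_le fun hK => ?_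
  rw [withDensity_apply _ hK.measurableSet]
  exact key K hKA hK

/-! ### Weak gradients and translations inside the domain. -/

/-- The weak gradient tested in an arbitrary direction. -/
lemma HasWeakGradient.integral_fderiv {N : ℕ} {Ω : Set (E N)} {u : E N → ℝ} {G : E N → E N}
    (hG : HasWeakGradient Ω u G) (hu : IntegrableOn u Ω) (hGi : IntegrableOn G Ω)
    {φ : E N → ℝ} (hφ : ContDiff ℝ ∞ φ) (hc : HasCompactSupport φ) (hs : tsupport φ ⊆ Ω)
    (v : E N) :
    ∫ x in Ω, u x * fderiv ℝ φ x v = -∫ x in Ω, ⟪G x, v⟫ * φ x := by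
  have hv : v = ∑ i, v i • EuclideanSpace.single i (1 : ℝ) := by
    ext j
    simp [Finset.sum_apply, Pi.single_apply]
  have hcont : ∀ w, Continuous fun x => fderiv ℝ φ x w := fun w =>
    (hφ.continuous_fderiv (by simp)).clm_apply continuous_const
  obtain ⟨M, hM⟩ := hc.exists_bound_of_continuous hφ.continuous
  have i1 : ∀ i, IntegrableOn (fun x => u x * fderiv ℝ φ x (EuclideanSpace.single i 1)) Ω := by
    intro i
    obtain ⟨M', hM'⟩ := (hc.fderiv_apply (𝕜 := ℝ)
      (EuclideanSpace.single i 1)).exists_bound_of_continuous (hcont (EuclideanSpace.single i 1))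
    exact Integrable.mul_bdd (c := M') hu (hcont _).aestronglyMeasurable (Eventually.of_forall hM')
  have i2 : ∀ i, IntegrableOn (fun x => G x i * φ x) Ω := by
    intro i
    have := (EuclideanSpace.proj (𝕜 := ℝ) i).integrable_comp hGi
    exact Integrable.mul_bdd (c := M) this hφ.continuous.aestronglyMeasurable (Eventually.of_forall hM)
  calc ∫ x in Ω, u x * fderiv ℝ φ x v
      = ∫ x in Ω, ∑ i, v i * (u x * fderiv ℝ φ x (EuclideanSpace.single i 1)) := by
        congr 1; ext x
        conv_lhs => rw [hv]
        rw [map_sum, Finset.mul_sum]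
        refine Finset.sum_congr rfl fun i _ => ?_
        rw [map_smul, smul_eq_mul]; ring
    _ = ∑ i, v i * ∫ x in Ω, u x * fderiv ℝ φ x (EuclideanSpace.single i 1) := by
        rw [integral_finsetSum _ fun i _ => (i1 i).const_mul _]
        simp_rw [integral_const_mul]
    _ = -∑ i, ∫ x in Ω, v i * (G x i * φ x) := by
        rw [← Finset.sum_neg_distrib]
        refine Finset.sum_congr rfl fun i _ => ?_
        rw [hG.2.2 φ hφ hc hs i, integral_const_mul]; ring
    _ = -∫ x in Ω, ⟪G x, v⟫ * φ x := by
        rw [← integral_finsetSum _ fun i _ => (i2 i).const_mul _]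
        congr 2; ext x
        rw [PiLp.inner_apply, Finset.sum_mul]
        refine Finset.sum_congr rfl fun i _ => ?_
        simp; ring

/-- Translation estimate inside `Ω`. -/
lemma HasWeakGradient.lintegral_translate_sub_le {N : ℕ} {Ω : Set (E N)} (hΩ : IsOpen Ω)
    {u : E N → ℝ} {G : E N → E N}
    (hG : HasWeakGradient Ω u G) (hu : IntegrableOn u Ω) (hGi : IntegrableOn G Ω)
    {A : Set (E N)} (hA : IsOpen A) {v : E N} {s : ℝ} (hs : 0 ≤ s)
    (hAΩ : ∀ x ∈ A, ∀ t ∈ Icc 0 s, x + t • v ∈ Ω) :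
    ∫⁻ x in A, ‖Ω.indicator u (x + s • v) - Ω.indicator u x‖ₑ
      ≤ ENNReal.ofReal (s * ‖v‖) * ∫⁻ x in Ω, ‖G x‖ₑ := by
  have hu0 : Integrable (Ω.indicator u) := hu.integrable_indicator hΩ.measurableSet
  rw [← ofReal_integral_norm_eq_lintegral_enorm hGi, ← ENNReal.ofReal_mul (by positivity)]
  refine lintegral_enorm_le_of_testFunctions ((hu0.comp_add_right _).sub hu0) hA ?_
  intro ζ hζ hc hsupp h1
  -- Translating the test function instead of `u` makes the pairing differentiable in `t`. Its
  -- derivative is a pairing with `∇u`, since `hAΩ` keeps the translated support in `Ω`; the mean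
  -- value inequality then bounds `F s - F 0`.
  let F : ℝ → ℝ := fun t => ∫ x, Ω.indicator u x * ζ (x - t • v)
  let F' : ℝ → ℝ := fun t => ∫ x, Ω.indicator u x * -fderiv ℝ ζ (x - t • v) v
  have hcont : Continuous fun x => fderiv ℝ ζ x v :=
    (hζ.continuous_fderiv (by simp)).clm_apply continuous_const
  obtain ⟨M, hM⟩ := (hc.fderiv_apply (𝕜 := ℝ) v).exists_bound_of_continuous hcont
  have hζi : ∀ t : ℝ, Integrable fun x => Ω.indicator u x * ζ (x - t • v) := fun t =>
    Integrable.mul_bdd (c := 1) hu0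
      (hζ.continuous.comp (continuous_id.sub continuous_const)).aestronglyMeasurable
      (Eventually.of_forall fun x => h1 _)
  have hder : ∀ t, HasDerivAt F (F' t) t := by
    intro t
    refine (hasDerivAt_integral_of_dominated_loc_of_deriv_le (s := univ)
      (F' := fun t x => Ω.indicator u x * -fderiv ℝ ζ (x - t • v) v)
      (bound := fun x => |Ω.indicator u x| * M) univ_mem
      (Eventually.of_forall fun t => (hζi t).1) (hζi t) ?_ ?_ (hu0.abs.mul_const M) ?_).2
    · exact hu0.1.mul
        (hcont.comp (continuous_id.sub continuous_const)).neg.aestronglyMeasurable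
    · refine Eventually.of_forall fun x t _ => ?_
      rw [norm_mul, norm_neg]
      exact mul_le_mul_of_nonneg_left (hM _) (abs_nonneg _)
    · refine Eventually.of_forall fun x t _ => ?_
      have hd : HasFDerivAt ζ (fderiv ℝ ζ (x - t • v)) (x - t • v) :=
        (hζ.differentiable (by simp) _).hasFDerivAt
      have hl : HasDerivAt (fun t : ℝ => x - t • v) (-v) t := by
        simpa using ((hasDerivAt_id t).smul_const v).const_sub x
      have := (hd.comp_hasDerivAt t hl).const_mul (Ω.indicator u x)
      simpa using this
  have hbound : ∀ t ∈ Ico 0 s, ‖F' t‖ ≤ ‖v‖ * ∫ x in Ω, ‖G x‖ := by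
    intro t ht
    let ζt : E N → ℝ := fun x => ζ (x - t • v)
    have e0 : ∀ x, fderiv ℝ ζt x = fderiv ℝ ζ (x - t • v) := fun x => by
      simp only [ζt]; rw [fderiv_comp_sub]
    have hts : tsupport ζt ⊆ (fun x => x - t • v) ⁻¹' tsupport ζ :=
      closure_minimal (fun x hx => subset_tsupport ζ hx)
        ((isClosed_tsupport ζ).preimage (continuous_id.sub continuous_const))
    have e1 : F' t = ∫ x in Ω, ⟪G x, v⟫ * ζt x := by
      have := hG.integral_fderiv hu hGi (φ := ζt) (hζ.comp (contDiff_id.sub contDiff_const))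
        (hc.comp_homeomorph (Homeomorph.subRight (t • v))) (fun x hx => by
          simpa using hAΩ _ (hsupp (hts hx)) t ⟨ht.1, ht.2.le⟩) v
      rw [← neg_eq_iff_eq_neg] at this
      rw [← this, ← integral_neg, ← integral_indicator hΩ.measurableSet]
      refine integral_congr_ae (Eventually.of_forall fun x => ?_)
      by_cases hx : x ∈ Ω <;> simp [hx, e0]
    rw [e1, ← integral_const_mul]
    refine norm_integral_le_of_norm_le (hGi.norm.const_mul _) (Eventually.of_forall fun x => ?_)
    rw [norm_mul]
    calc ‖⟪G x, v⟫‖ * ‖ζt x‖ ≤ (‖G x‖ * ‖v‖) * 1 :=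
          mul_le_mul (norm_inner_le_norm _ _) (h1 _) (norm_nonneg _) (by positivity)
      _ = ‖v‖ * ‖G x‖ := by ring
  have hmv := norm_image_sub_le_of_norm_deriv_le_segment' (f := F) (f' := F') (a := 0) (b := s)
    (fun t _ => (hder t).hasDerivWithinAt) hbound s (right_mem_Icc.2 hs)
  have hFs : F s = ∫ x, Ω.indicator u (x + s • v) * ζ x := by
    change ∫ x, Ω.indicator u x * ζ (x - s • v) = _
    rw [← integral_add_right_eq_self (μ := volume)
      (fun x => Ω.indicator u x * ζ (x - s • v)) (s • v)]
    simp
  have hF0 : F 0 = ∫ x, Ω.indicator u x * ζ x := by simp [F]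
  have hfin : F s - F 0 = ∫ x, (Ω.indicator u (x + s • v) - Ω.indicator u x) * ζ x := by
    rw [hFs, hF0, ← integral_sub]
    · simp_rw [sub_mul]
    · simpa using (hζi s).comp_add_right (s • v)
    · simpa using hζi 0
  change |∫ x, (Ω.indicator u (x + s • v) - Ω.indicator u x) * ζ x| ≤ _
  rw [← hfin]
  calc |F s - F 0| ≤ (‖v‖ * ∫ x in Ω, ‖G x‖) * (s - 0) := hmv
    _ = _ := by ring

/-! ### Thin strips and translations across the boundary. -/

/-- If the translates `P + k w`, `k < K`, are disjoint subsets of `A`, then the integrals over them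
add up to at most the integral over `A`. -/
lemma sum_lintegral_translates_le {N : ℕ} (F : E N → ℝ≥0∞) {P A : Set (E N)}
    (hP : MeasurableSet P) {w : E N} {K : ℕ}
    (hdisj : ∀ x : E N, ∀ j < K, ∀ k < K, x - (j : ℝ) • w ∈ P → x - (k : ℝ) • w ∈ P → j = k)
    (hsub : ∀ y ∈ P, ∀ k < K, y + (k : ℝ) • w ∈ A) :
    ∑ k ∈ Finset.range K, ∫⁻ y in P, F (y + (k : ℝ) • w) ≤ ∫⁻ x in A, F x := by
  let Q : ℕ → Set (E N) := fun k => (fun x => x - (k : ℝ) • w) ⁻¹' P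
  have hQ : ∀ k, MeasurableSet (Q k) := fun k => (measurable_id.sub_const _) hP
  have e : ∀ k : ℕ, ∫⁻ y in P, F (y + (k : ℝ) • w) = ∫⁻ x in Q k, F x := by
    intro k
    rw [← lintegral_indicator hP, ← lintegral_indicator (hQ k),
      ← lintegral_add_right_eq_self ((Q k).indicator F) ((k : ℝ) • w)]
    refine lintegral_congr fun x => ?_
    have hx : x + (k : ℝ) • w ∈ Q k ↔ x ∈ P := by
      change x + (k : ℝ) • w - (k : ℝ) • w ∈ P ↔ _
      rw [add_sub_cancel_right]
    by_cases h : x ∈ P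
    · rw [indicator_of_mem h, indicator_of_mem (hx.2 h)]
    · rw [indicator_of_notMem h, indicator_of_notMem (mt hx.1 h)]
  simp_rw [e]
  rw [← lintegral_biUnion_finset (fun j hj k hk hjk => ?_) (fun k _ => hQ k)]
  · refine lintegral_mono_set (iUnion₂_subset fun k hk x hx => ?_)
    simpa using hsub _ hx k (Finset.mem_range.1 hk)
  · refine Set.disjoint_left.2 fun x hx hx' => hjk ?_
    exact hdisj x j (by simpa using hj) k (by simpa using hk) hx hx'

/-- Telescoping along `y, y + w, …, y + k w`. -/
lemma enorm_le_enorm_add_sum {N : ℕ} (f : E N → ℝ) (w y : E N) (k : ℕ) :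
    ‖f y‖ₑ ≤ ‖f (y + (k : ℝ) • w)‖ₑ +
      ∑ j ∈ Finset.range k, ‖f (y + (j : ℝ) • w + w) - f (y + (j : ℝ) • w)‖ₑ := by
  induction k with
  | zero => simp
  | succ k ih =>
    refine ih.trans ?_
    rw [Finset.sum_range_succ, add_comm (∑ j ∈ _, _), ← add_assoc]
    gcongr
    have : y + ((k + 1 : ℕ) : ℝ) • w = y + (k : ℝ) • w + w := by
      push_cast; module
    rw [this]
    calc ‖f (y + (k : ℝ) • w)‖ₑ
        = ‖f (y + (k : ℝ) • w + w) - (f (y + (k : ℝ) • w + w) - f (y + (k : ℝ) • w))‖ₑ := by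
          congr 1; ring
      _ ≤ _ := enorm_sub_le

/-- A thin set having many disjoint translates inside `A` carries little mass of `f`. -/
lemma natCast_mul_lintegral_le {N : ℕ} {f : E N → ℝ} (hf : AEStronglyMeasurable f volume)
    {P A : Set (E N)} (hP : MeasurableSet P) {w : E N} {K : ℕ}
    (hdisj : ∀ x : E N, ∀ j < K, ∀ k < K, x - (j : ℝ) • w ∈ P → x - (k : ℝ) • w ∈ P → j = k)
    (hsub : ∀ y ∈ P, ∀ k < K, y + (k : ℝ) • w ∈ A) :
    K * ∫⁻ x in P, ‖f x‖ₑ ≤ (∫⁻ x in A, ‖f x‖ₑ) + K * ∫⁻ x in A, ‖f (x + w) - f x‖ₑ := by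
  have hfw : ∀ z, AEStronglyMeasurable (fun x => f (x + z)) volume := fun z =>
    hf.comp_measurePreserving (measurePreserving_add_right volume z)
  -- Disjointness of the translates lets all `k` telescoping errors together cost a single integral
  -- over `A`, independent of `k`.
  have h1 : ∀ k ∈ Finset.range K, ∫⁻ x in P, ‖f x‖ₑ ≤ (∫⁻ x in P, ‖f (x + (k : ℝ) • w)‖ₑ) +
      ∫⁻ x in A, ‖f (x + w) - f x‖ₑ := by
    intro k hk
    have hk := Finset.mem_range.1 hk
    calc ∫⁻ x in P, ‖f x‖ₑ ≤ ∫⁻ x in P, (‖f (x + (k : ℝ) • w)‖ₑ +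
          ∑ j ∈ Finset.range k, ‖f (x + (j : ℝ) • w + w) - f (x + (j : ℝ) • w)‖ₑ) :=
          lintegral_mono fun x => enorm_le_enorm_add_sum f w x k
      _ = (∫⁻ x in P, ‖f (x + (k : ℝ) • w)‖ₑ) + ∑ j ∈ Finset.range k,
          ∫⁻ x in P, ‖f (x + (j : ℝ) • w + w) - f (x + (j : ℝ) • w)‖ₑ := by
          rw [lintegral_add_left' (hfw _).enorm.restrict, lintegral_finsetSum']
          intro j _
          refine AEMeasurable.restrict (AEStronglyMeasurable.enorm (.sub ?_ (hfw _)))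
          simpa only [add_assoc] using hfw ((j : ℝ) • w + w)
      _ ≤ _ := by
          gcongr
          exact sum_lintegral_translates_le (fun x => ‖f (x + w) - f x‖ₑ) hP
            (fun x i hi j hj => hdisj x i (hi.trans hk) j (hj.trans hk))
            (fun y hy j hj => hsub y hy j (hj.trans hk))
  have h2 := Finset.sum_le_sum h1
  rw [Finset.sum_const, Finset.card_range, nsmul_eq_mul, Finset.sum_add_distrib, Finset.sum_const,
    Finset.card_range, nsmul_eq_mul] at h2
  refine h2.trans ?_
  gcongr
  exact sum_lintegral_translates_le (fun x => ‖f x‖ₑ) hP hdisj hsub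

/-- Translation estimate for the extension by zero, near a point where `Ω` is closed under
translation in direction `v`. -/
lemma HasWeakGradient.lintegral_ball_translate_le {N : ℕ} {Ω : Set (E N)} (hΩ : IsOpen Ω)
    {u : E N → ℝ} {G : E N → E N}
    (hG : HasWeakGradient Ω u G) (hu : IntegrableOn u Ω) (hGi : IntegrableOn G Ω)
    {x₀ v : E N} {R t₀ s : ℝ} (ht₀ : 0 < t₀) (hR : 8 * t₀ ≤ R) (hv : ‖v‖ ≤ 2)
    (hcone : ∀ x ∈ Ω ∩ ball x₀ R, ∀ t ∈ Icc 0 t₀, x + t • v ∈ Ω)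
    (hs : 0 < s) (hst : 2 * s ≤ t₀) :
    ∫⁻ x in ball x₀ (R / 2), ‖Ω.indicator u (x + s • v) - Ω.indicator u x‖ₑ
      ≤ ENNReal.ofReal (s * (2 / t₀ + 4)) * ((∫⁻ x in Ω, ‖u x‖ₑ) + ∫⁻ x in Ω, ‖G x‖ₑ) := by
  set u₀ := Ω.indicator u with hu₀
  set W := ∫⁻ x in Ω, ‖u x‖ₑ
  set D := ∫⁻ x in Ω, ‖G x‖ₑ
  have hui : Integrable u₀ := hu.integrable_indicator hΩ.measurableSet
  let A : Set (E N) := Ω ∩ ball x₀ R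
  have hA : IsOpen A := hΩ.inter isOpen_ball
  have hT : ∫⁻ x in A, ‖u₀ (x + s • v) - u₀ x‖ₑ ≤ ENNReal.ofReal (2 * s) * D := by
    refine (hG.lintegral_translate_sub_le hΩ hu hGi hA hs.le
      fun x hx t ht => hcone x hx t ⟨ht.1, by linarith [ht.2]⟩).trans ?_
    gcongr ENNReal.ofReal ?_ * D
    nlinarith
  have hW : ∫⁻ x in A, ‖u₀ x‖ₑ ≤ W := by
    calc ∫⁻ x in A, ‖u₀ x‖ₑ ≤ ∫⁻ x in Ω, ‖u₀ x‖ₑ := lintegral_mono_set inter_subset_left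
      _ = W := setLIntegral_congr_fun hΩ.measurableSet fun x hx => by simp [u₀, hx]
  -- The strip of points that one step `s • v` carries into `Ω` from the outside part of the half
  -- ball.
  let P : Set (E N) := Ω ∩ (fun x => x - s • v) ⁻¹' (ball x₀ (R / 2) \ Ω)
  have hP : MeasurableSet P := hΩ.measurableSet.inter
    ((measurable_id.sub_const _) (measurableSet_ball.diff hΩ.measurableSet))
  -- The number of steps of length `s` that fit in `[0, t₀]`; `2 * s ≤ t₀` prevents the floor from
  -- losing more than a factor 2.
  let K : ℕ := ⌊t₀ / s⌋₊
  have hK1 : (K : ℝ) * s ≤ t₀ := by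
    have := Nat.floor_le (div_nonneg ht₀.le hs.le)
    rwa [le_div_iff₀ hs] at this
  have hK2 : t₀ / (2 * s) ≤ K := by
    have h1 : t₀ / s < K + 1 := Nat.lt_floor_add_one _
    have h2 : t₀ / s = 2 * (t₀ / (2 * s)) := by field_simp
    have h3 : 1 ≤ t₀ / (2 * s) := by rw [le_div_iff₀ (by positivity)]; linarith
    linarith
  -- Measured from `y - s • v`, which lies in the half ball, the displacement is `(k + 1) * s ≤ t₀`
  -- times `v`, of length at most `2 * t₀ ≤ R / 4`.
  have hPA : ∀ y ∈ P, ∀ k < K, y + (k : ℝ) • s • v ∈ A := by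
    intro y hy k hk
    have hk' : ((k : ℝ) + 1) * s ≤ t₀ := by
      refine le_trans ?_ hK1
      have : ((k : ℝ) + 1) ≤ K := by exact_mod_cast hk
      gcongr
    have hks : 0 ≤ (k : ℝ) * s := by positivity
    have hy1 : ‖y - s • v - x₀‖ < R / 2 := by simpa [dist_eq_norm] using hy.2.1
    have hyR : ∀ a : ℝ, 0 ≤ a → a ≤ t₀ → ‖y - s • v + a • v - x₀‖ < R := by
      intro a ha ha'
      have : y - s • v + a • v - x₀ = (y - s • v - x₀) + a • v := by module
      rw [this]
      refine (norm_add_le _ _).trans_lt ?_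
      rw [norm_smul, Real.norm_eq_abs, abs_of_nonneg ha]
      nlinarith
    refine ⟨?_, ?_⟩
    · have hyA : y ∈ Ω ∩ ball x₀ R := ⟨hy.1, by
        have := hyR s hs.le (by linarith)
        simpa [dist_eq_norm] using this⟩
      have := hcone y hyA (k * s) ⟨by positivity, by nlinarith⟩
      rwa [mul_smul] at this
    · have := hyR ((k + 1) * s) (by positivity) hk'
      rw [mem_ball, dist_eq_norm]
      have e : y + (k : ℝ) • s • v - x₀ = y - s • v + (((k : ℝ) + 1) * s) • v - x₀ := by module
      rwa [e]
  -- Climbing `k - j - 1` steps from `x - k s v` reaches `x - (j + 1) s v`, which is therefore in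
  -- `Ω`; but `x - j s v ∈ P` puts that point outside.
  have hdisj' : ∀ x : E N, ∀ j k : ℕ, j < k → k < K →
      x - (j : ℝ) • s • v ∈ P → x - (k : ℝ) • s • v ∈ P → False := by
    intro x j k hjk hk hj hxk
    obtain ⟨m, rfl⟩ := Nat.exists_eq_add_of_lt hjk
    refine hj.2.2 ?_
    have := (hPA _ hxk m (by omega)).1
    convert this using 1
    push_cast
    module
  have hdisj : ∀ x : E N, ∀ j < K, ∀ k < K, x - (j : ℝ) • s • v ∈ P → x - (k : ℝ) • s • v ∈ P →
      j = k := by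
    intro x j hj k hk hxj hxk
    rcases lt_trichotomy j k with h | h | h
    · exact (hdisj' x j k h hk hxj hxk).elim
    · exact h
    · exact (hdisj' x k j h hj hxk hxj).elim
  have hKpos : (0 : ℝ) < K := lt_of_lt_of_le (by positivity) hK2
  have hK0 : (K : ℝ≥0∞) ≠ 0 := by
    have : K ≠ 0 := by rintro h; simp [h] at hKpos
    exact_mod_cast this
  have hKinv : (K : ℝ≥0∞)⁻¹ ≤ ENNReal.ofReal (2 * s / t₀) := by
    rw [← ENNReal.ofReal_natCast, ← ENNReal.ofReal_inv_of_pos hKpos]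
    refine ENNReal.ofReal_le_ofReal ?_
    rw [← inv_div]
    exact inv_anti₀ (by positivity) hK2
  have hstrip : ∫⁻ x in P, ‖u₀ x‖ₑ ≤ ENNReal.ofReal (2 * s / t₀) * W +
      ENNReal.ofReal (2 * s) * D := by
    have h := natCast_mul_lintegral_le hui.1 hP hdisj hPA
    calc ∫⁻ x in P, ‖u₀ x‖ₑ = (K : ℝ≥0∞)⁻¹ * (K * ∫⁻ x in P, ‖u₀ x‖ₑ) := by
          rw [← mul_assoc, ENNReal.inv_mul_cancel hK0 (by simp), one_mul]
      _ ≤ (K : ℝ≥0∞)⁻¹ * (W + K * (ENNReal.ofReal (2 * s) * D)) := by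
          gcongr
          exact h.trans (by gcongr)
      _ = (K : ℝ≥0∞)⁻¹ * W + ENNReal.ofReal (2 * s) * D := by
          rw [mul_add, ← mul_assoc _ (K : ℝ≥0∞), ENNReal.inv_mul_cancel hK0 (by simp), one_mul]
      _ ≤ _ := by gcongr
  -- Outside `Ω` the difference is just `u₀ (x + s • v)`, nonzero only when the step lands in `P`.
  have hout : ∫⁻ x in ball x₀ (R / 2) \ Ω, ‖u₀ (x + s • v) - u₀ x‖ₑ = ∫⁻ x in P, ‖u₀ x‖ₑ := by
    rw [← lintegral_indicator (measurableSet_ball.diff hΩ.measurableSet),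
      ← lintegral_indicator hP,
      ← lintegral_add_right_eq_self (P.indicator fun x => ‖u₀ x‖ₑ) (s • v)]
    refine lintegral_congr fun x => ?_
    by_cases hx : x ∈ ball x₀ (R / 2) \ Ω
    · by_cases hx' : x + s • v ∈ Ω
      · have : x + s • v ∈ P := ⟨hx', by simpa using hx⟩
        rw [indicator_of_mem hx, indicator_of_mem this]
        simp [u₀, hx.2]
      · have : x + s • v ∉ P := fun h => hx' h.1
        rw [indicator_of_mem hx, indicator_of_notMem this]
        simp [u₀, hx.2, hx']
    · have : x + s • v ∉ P := fun h => hx (by simpa using h.2)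
      rw [indicator_of_notMem hx, indicator_of_notMem this]
  calc ∫⁻ x in ball x₀ (R / 2), ‖u₀ (x + s • v) - u₀ x‖ₑ
      = (∫⁻ x in ball x₀ (R / 2) ∩ Ω, ‖u₀ (x + s • v) - u₀ x‖ₑ) +
        ∫⁻ x in ball x₀ (R / 2) \ Ω, ‖u₀ (x + s • v) - u₀ x‖ₑ :=
        (lintegral_inter_add_sdiff _ _ hΩ.measurableSet).symm
    _ ≤ ENNReal.ofReal (2 * s) * D + (ENNReal.ofReal (2 * s / t₀) * W +
        ENNReal.ofReal (2 * s) * D) := by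
        rw [hout]
        gcongr
        refine (lintegral_mono_set ?_).trans hT
        rintro x ⟨hx, hx'⟩
        exact ⟨hx', ball_subset_ball (by linarith) hx⟩
    _ = ENNReal.ofReal (2 * s / t₀) * W + ENNReal.ofReal (4 * s) * D := by
        rw [add_left_comm, ← add_mul, ← ENNReal.ofReal_add (by positivity) (by positivity)]
        ring_nf
    _ ≤ ENNReal.ofReal (s * (2 / t₀ + 4)) * W + ENNReal.ofReal (s * (2 / t₀ + 4)) * D := by
        gcongr ENNReal.ofReal ?_ * _ + ENNReal.ofReal ?_ * _
        · have : 2 * s / t₀ = s * (2 / t₀) := by ring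
          rw [this]; gcongr; linarith
        · have : 0 ≤ s * (2 / t₀) := by positivity
          linarith
    _ = _ := (mul_add _ _ _).symm

/-! ### Geometry of the boundary and bounded variation of the zero extension. -/

/-- Local cone property of domains with `C¹` boundary. -/
lemma HasC1Boundary.exists_cone {N : ℕ} {Ω : Set (E N)} (hΩ : IsOpen Ω) (h : HasC1Boundary Ω)
    (x₀ : E N) : ∃ (e : E N) (η R t₀ : ℝ), ‖e‖ ≤ 1 ∧ 0 < η ∧ η ≤ 1 ∧ 0 < t₀ ∧ 8 * t₀ ≤ R ∧
      ∀ v, ‖v - e‖ ≤ η → ∀ x ∈ Ω ∩ ball x₀ R, ∀ t ∈ Icc 0 t₀, x + t • v ∈ Ω := by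
  have hball : ∀ {r t : ℝ} {v x : E N}, 0 < r → ‖v‖ ≤ 2 → x ∈ ball x₀ (r / 2) →
      t ∈ Icc 0 (r / 16) → x + t • v ∈ ball x₀ r := by
    intro r t v x hr hv hx ht
    have h1 : ‖x - x₀‖ < r / 2 := by simpa [dist_eq_norm] using hx
    rw [mem_ball, dist_eq_norm, add_sub_right_comm]
    refine (norm_add_le _ _).trans_lt ?_
    rw [norm_smul, Real.norm_eq_abs, abs_of_nonneg ht.1]
    nlinarith [ht.1, ht.2, norm_nonneg v]
  by_cases h1 : x₀ ∈ Ω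
  · obtain ⟨r, hr, hrΩ⟩ := Metric.isOpen_iff.1 hΩ x₀ h1
    -- At an interior point no direction is preferred: the axis is 0 and the unit ball of directions
    -- works.
    refine ⟨0, 1, r / 2, r / 16, by simp, one_pos, le_rfl, by positivity, by linarith, ?_⟩
    intro v hv x hx t ht
    exact hrΩ (hball hr (by simp at hv; linarith) hx.2 ht)
  by_cases h2 : x₀ ∈ closure Ω
  · obtain ⟨r, hr, e, he, γ, hγ, hgraph⟩ := h x₀ ⟨h2, by rwa [hΩ.interior_eq]⟩
    let P : E N → E N := fun x => x - ⟪e, x⟫ • e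
    have hP : Continuous P := by fun_prop
    obtain ⟨K, S, hS, hLip⟩ := hγ.contDiffAt (x := P x₀) |>.exists_lipschitzOnWith
    obtain ⟨r₂, hr₂, hrS⟩ := Metric.mem_nhds_iff.1 (hP.continuousAt.preimage_mem_nhds hS)
    have hr₀ : 0 < min r r₂ := lt_min hr hr₂
    have hK : (0 : ℝ) ≤ K := K.2
    have hη1 : 1 / (2 * (K : ℝ) + 1) ≤ 1 := by
      rw [div_le_one (by positivity)]; linarith
    -- With `K` a Lipschitz constant of `γ`, moving by `t • v` raises the height by at least `t (1 -
    -- η)` and the graph by at most `2 K η t`. This `η` makes the two equal.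
    refine ⟨e, 1 / (2 * K + 1), min r r₂ / 2, min r r₂ / 16, he.le, by positivity, hη1,
      by positivity, by linarith, ?_⟩
    intro v hv x hx t ht
    set η := 1 / (2 * (K : ℝ) + 1) with hη
    have hηK : η * (2 * K + 1) = 1 := by rw [hη]; field_simp
    have hv2 : ‖v‖ ≤ 2 := by
      have : v = (v - e) + e := by abel
      rw [this]
      linarith [norm_add_le (v - e) e]
    have hxt := hball hr₀ hv2 hx.2 ht
    have hx' : x ∈ ball x₀ (min r r₂) := ball_subset_ball (by linarith) hx.2
    have hxr := ball_subset_ball (min_le_left r r₂) hx'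
    have hxtr := ball_subset_ball (min_le_left r r₂) hxt
    have hgx := (hgraph x hxr).1 hx.1
    refine (hgraph _ hxtr).2 ?_
    have hl := hLip.dist_le_mul (P (x + t • v)) (hrS (ball_subset_ball (min_le_right r r₂) hxt))
      (P x) (hrS (ball_subset_ball (min_le_right r r₂) hx'))
    have hee : ⟪e, e⟫ = 1 := by rw [real_inner_self_eq_norm_sq, he]; norm_num
    have hin : |⟪e, v - e⟫| ≤ η := by
      refine (abs_real_inner_le_norm _ _).trans ?_
      rw [he, one_mul]; exact hv
    have hev : ⟪e, v⟫ = 1 + ⟪e, v - e⟫ := by rw [inner_sub_right, hee]; ring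
    have hPd : P (x + t • v) - P x = t • ((v - e) - ⟪e, v - e⟫ • e) := by
      simp only [P, inner_add_right, inner_smul_right, inner_sub_right, hee]
      module
    have hPn : ‖P (x + t • v) - P x‖ ≤ t * (2 * η) := by
      rw [hPd, norm_smul, Real.norm_eq_abs, abs_of_nonneg ht.1]
      refine mul_le_mul_of_nonneg_left ?_ ht.1
      refine (norm_sub_le _ _).trans ?_
      rw [norm_smul, he, Real.norm_eq_abs]
      linarith
    have hγd : γ (P (x + t • v)) - γ (P x) ≤ K * (t * (2 * η)) := by
      refine (le_abs_self _).trans ?_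
      rw [← Real.dist_eq]
      refine hl.trans (mul_le_mul_of_nonneg_left ?_ hK)
      rwa [dist_eq_norm]
    have hdir : ⟪e, x + t • v⟫ = ⟪e, x⟫ + t * ⟪e, v⟫ := by
      rw [inner_add_right, inner_smul_right]
    change γ (P (x + t • v)) < _
    change γ (P x) < _ at hgx
    rw [hdir, hev]
    have h3 : t * (1 - η) ≤ t * (1 + ⟪e, v - e⟫) :=
      mul_le_mul_of_nonneg_left (by linarith [neg_le_of_abs_le hin]) ht.1
    have h4 : K * (t * (2 * η)) = t * (1 - η) := by rw [← hηK]; ring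
    linarith
  · obtain ⟨r, hr, hrΩ⟩ := Metric.isOpen_iff.1 isClosed_closure.isOpen_compl x₀ h2
    refine ⟨0, 1, r, r / 8, by simp, one_pos, le_rfl, by positivity, by linarith, ?_⟩
    intro v _ x hx
    exact absurd (subset_closure hx.1) (hrΩ hx.2)

lemma setLIntegral_comp_add_le {N : ℕ} (F : E N → ℝ≥0∞) {A B : Set (E N)} (hA : MeasurableSet A)
    (hB : MeasurableSet B) (z : E N) (hAB : ∀ x ∈ A, x + z ∈ B) :
    ∫⁻ x in A, F (x + z) ≤ ∫⁻ x in B, F x := by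
  rw [← lintegral_indicator hA, ← lintegral_indicator hB,
    ← lintegral_add_right_eq_self (B.indicator F) z]
  refine lintegral_mono fun x => ?_
  by_cases hx : x ∈ A
  · rw [indicator_of_mem hx, indicator_of_mem (hAB x hx)]
  · rw [indicator_of_notMem hx]; exact zero_le

/-- Functions with an integrable weak gradient, extended by zero, have locally bounded variation. -/
lemma HasC1Boundary.exists_local_translate_le {N : ℕ} {Ω : Set (E N)} (hΩ : IsOpen Ω)
    (h : HasC1Boundary Ω) (x₀ : E N) : ∃ ρ > 0, ∃ s₁ > 0, ∃ C ≥ 0, ∀ (u : E N → ℝ) (G : E N → E N),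
      HasWeakGradient Ω u G → IntegrableOn u Ω → IntegrableOn G Ω → ∀ y : E N, ‖y‖ ≤ s₁ →
        ∫⁻ x in ball x₀ ρ, ‖Ω.indicator u (x + y) - Ω.indicator u x‖ₑ
          ≤ ENNReal.ofReal (C * ‖y‖) * ((∫⁻ x in Ω, ‖u x‖ₑ) + ∫⁻ x in Ω, ‖G x‖ₑ) := by
  obtain ⟨e, η, R, t₀, he, hη, hη1, ht₀, hR, hcone⟩ := h.exists_cone hΩ x₀
  refine ⟨R / 4, by linarith, η * t₀ / 2, by positivity, 2 * (2 / t₀ + 4) / η, by positivity, ?_⟩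
  intro u G hG hu hGi y hy
  rcases eq_or_ne y 0 with rfl | hy0
  · simp
  have hyp : 0 < ‖y‖ := norm_pos_iff.2 hy0
  -- This `s` is the one for which `v = e + y / s` is at distance exactly `η` from `e`. Then `y = -s
  -- e + s v`: after the shift by `-s e`, the increment of `u₀` along `y` is a difference of two
  -- cone increments, along `v` and along `e`.
  set s := ‖y‖ / η with hs
  have hspos : 0 < s := by positivity
  have hst : 2 * s ≤ t₀ := by
    rw [hs, ← mul_div_assoc, div_le_iff₀ hη]; linarith
  set v := e + s⁻¹ • y with hv
  have hve : ‖v - e‖ ≤ η := by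
    rw [hv, add_sub_cancel_left, norm_smul, Real.norm_eq_abs, abs_of_pos (by positivity), hs]
    rw [inv_div, div_mul_cancel₀ _ hyp.ne']
  have hvn : ‖v‖ ≤ 2 := by
    have : v = (v - e) + e := by abel
    rw [this]
    linarith [norm_add_le (v - e) e]
  have hyv : y = -(s • e) + s • v := by
    rw [hv, smul_add, smul_smul, mul_inv_cancel₀ hspos.ne']; module
  set u₀ := Ω.indicator u with hu₀
  have hui : Integrable u₀ := hu.integrable_indicator hΩ.measurableSet
  have hsub : ∀ x ∈ ball x₀ (R / 4), x + -(s • e) ∈ ball x₀ (R / 2) := by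
    intro x hx
    have h1 : ‖x - x₀‖ < R / 4 := by simpa [dist_eq_norm] using hx
    rw [mem_ball, dist_eq_norm, add_sub_right_comm]
    refine (norm_add_le _ _).trans_lt ?_
    rw [norm_neg, norm_smul, Real.norm_eq_abs, abs_of_pos hspos]
    nlinarith [norm_nonneg e]
  have est : ∀ w, ‖w - e‖ ≤ η → ‖w‖ ≤ 2 →
      ∫⁻ x in ball x₀ (R / 4), ‖u₀ (x + -(s • e) + s • w) - u₀ (x + -(s • e))‖ₑ ≤
      ENNReal.ofReal (s * (2 / t₀ + 4)) * ((∫⁻ x in Ω, ‖u x‖ₑ) + ∫⁻ x in Ω, ‖G x‖ₑ) :=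
    fun w hw hw2 => (setLIntegral_comp_add_le (fun x => ‖u₀ (x + s • w) - u₀ x‖ₑ)
      measurableSet_ball measurableSet_ball _ hsub).trans
      (hG.lintegral_ball_translate_le hΩ hu hGi ht₀ hR hw2 (hcone w hw) hspos hst)
  have hmeas : ∀ z, AEStronglyMeasurable (fun x => u₀ (x + z)) volume := fun z =>
    hui.1.comp_measurePreserving (measurePreserving_add_right volume z)
  calc ∫⁻ x in ball x₀ (R / 4), ‖u₀ (x + y) - u₀ x‖ₑ
      ≤ ∫⁻ x in ball x₀ (R / 4), (‖u₀ (x + -(s • e) + s • v) - u₀ (x + -(s • e))‖ₑ +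
        ‖u₀ (x + -(s • e) + s • e) - u₀ (x + -(s • e))‖ₑ) := by
        refine lintegral_mono fun x => ?_
        have e1 : x + y = x + -(s • e) + s • v := by rw [add_assoc, ← hyv]
        have e2 : u₀ (x + y) - u₀ x = (u₀ (x + -(s • e) + s • v) - u₀ (x + -(s • e))) -
            (u₀ (x + -(s • e) + s • e) - u₀ (x + -(s • e))) := by
          rw [neg_add_cancel_right, e1]; ring
        rw [e2]
        exact enorm_sub_le
    _ = (∫⁻ x in ball x₀ (R / 4), ‖u₀ (x + -(s • e) + s • v) - u₀ (x + -(s • e))‖ₑ) +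
        ∫⁻ x in ball x₀ (R / 4), ‖u₀ (x + -(s • e) + s • e) - u₀ (x + -(s • e))‖ₑ := by
        refine lintegral_add_left' (AEMeasurable.restrict ?_) _
        refine AEStronglyMeasurable.enorm (.sub ?_ (hmeas _))
        simpa only [add_assoc] using hmeas (-(s • e) + s • v)
    _ ≤ _ := add_le_add (est v hve hvn) (est e (by simpa using hη.le) (by linarith))
    _ = _ := by
        rw [← add_mul, ← ENNReal.ofReal_add (by positivity) (by positivity), hs]
        congr 2
        ring

/-- Functions with an integrable weak gradient, extended by zero, have bounded variation. -/
lemma HasC1Boundary.exists_translate_le {N : ℕ} {Ω : Set (E N)} (hΩ : IsOpen Ω)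
    (hb : Bornology.IsBounded Ω) (h : HasC1Boundary Ω) :
    ∃ C ≥ 0, ∀ (u : E N → ℝ) (G : E N → E N),
      HasWeakGradient Ω u G → IntegrableOn u Ω → IntegrableOn G Ω → ∀ y : E N,
        ∫⁻ x, ‖Ω.indicator u (x + y) - Ω.indicator u x‖ₑ
          ≤ ENNReal.ofReal (C * ‖y‖) * ((∫⁻ x in Ω, ‖u x‖ₑ) + ∫⁻ x in Ω, ‖G x‖ₑ) := by
  obtain ⟨r, hr⟩ := hb.subset_closedBall (0 : E N)
  have hloc : ∃ s₁ > 0, ∃ C ≥ 0, ∀ (u : E N → ℝ) (G : E N → E N),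
      HasWeakGradient Ω u G → IntegrableOn u Ω → IntegrableOn G Ω → ∀ y : E N, ‖y‖ ≤ s₁ →
        ∫⁻ x in closedBall 0 (r + 1), ‖Ω.indicator u (x + y) - Ω.indicator u x‖ₑ
          ≤ ENNReal.ofReal (C * ‖y‖) * ((∫⁻ x in Ω, ‖u x‖ₑ) + ∫⁻ x in Ω, ‖G x‖ₑ) := by
    -- The bound is inherited by subsets and adds up over finite unions, so compactness globalises
    -- it.
    refine (isCompact_closedBall (0 : E N) (r + 1)).induction_on (p := fun S =>
      ∃ s₁ > 0, ∃ C ≥ 0, ∀ (u : E N → ℝ) (G : E N → E N),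
      HasWeakGradient Ω u G → IntegrableOn u Ω → IntegrableOn G Ω → ∀ y : E N, ‖y‖ ≤ s₁ →
        ∫⁻ x in S, ‖Ω.indicator u (x + y) - Ω.indicator u x‖ₑ
          ≤ ENNReal.ofReal (C * ‖y‖) * ((∫⁻ x in Ω, ‖u x‖ₑ) + ∫⁻ x in Ω, ‖G x‖ₑ)) ?_ ?_ ?_ ?_
    · exact ⟨1, one_pos, 0, le_rfl, by simp⟩
    · rintro S T hST ⟨s₁, hs₁, C, hC, H⟩
      exact ⟨s₁, hs₁, C, hC, fun u G hG hu hGi y hy =>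
        (lintegral_mono_set hST).trans (H u G hG hu hGi y hy)⟩
    · rintro S T ⟨s₁, hs₁, C, hC, H⟩ ⟨s₂, hs₂, C', hC', H'⟩
      refine ⟨min s₁ s₂, lt_min hs₁ hs₂, C + C', add_nonneg hC hC', fun u G hG hu hGi y hy => ?_⟩
      refine (lintegral_union_le _ _ _).trans ?_
      rw [add_mul, ENNReal.ofReal_add (by positivity) (by positivity), add_mul]
      exact add_le_add (H u G hG hu hGi y (hy.trans (min_le_left _ _)))
        (H' u G hG hu hGi y (hy.trans (min_le_right _ _)))
    · intro x _
      obtain ⟨ρ, hρ, H⟩ := h.exists_local_translate_le hΩ x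
      exact ⟨ball x ρ, mem_nhdsWithin_of_mem_nhds (ball_mem_nhds x hρ), H⟩
  obtain ⟨s₁, hs₁, C, hC, H⟩ := hloc
  have hs : 0 < min s₁ 1 := lt_min hs₁ one_pos
  -- The second term handles long translations, where `2 ‖u‖₁` is a trivial bound. For short ones
  -- `‖y‖ ≤ 1`, so the increment vanishes outside the ball of radius `r + 1`.
  refine ⟨C + 2 / min s₁ 1, by positivity, fun u G hG hu hGi y => ?_⟩
  have hui : Integrable (Ω.indicator u) := hu.integrable_indicator hΩ.measurableSet
  have hW : ∫⁻ x, ‖Ω.indicator u x‖ₑ = ∫⁻ x in Ω, ‖u x‖ₑ := by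
    rw [← lintegral_indicator hΩ.measurableSet]
    refine lintegral_congr fun x => ?_
    by_cases hx : x ∈ Ω <;> simp [hx]
  rcases le_total ‖y‖ (min s₁ 1) with hy | hy
  · have heq : ∫⁻ x, ‖Ω.indicator u (x + y) - Ω.indicator u x‖ₑ =
        ∫⁻ x in closedBall 0 (r + 1), ‖Ω.indicator u (x + y) - Ω.indicator u x‖ₑ := by
      refine (setLIntegral_eq_of_support_subset fun x hx => ?_).symm
      by_contra hx'
      have hx1 : r + 1 < ‖x‖ := by simpa using hx'
      have hy1 := hy.trans (min_le_right _ _)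
      have h1 : x ∉ Ω := fun hxΩ => by
        have := hr hxΩ
        simp at this; linarith
      have h2 : x + y ∉ Ω := fun hxΩ => by
        have h3 : ‖x + y‖ ≤ r := by simpa using hr hxΩ
        have h4 := norm_sub_le (x + y) y
        rw [add_sub_cancel_right] at h4
        linarith
      exact hx (by simp [h1, h2])
    rw [heq]
    refine (H u G hG hu hGi y (hy.trans (min_le_left _ _))).trans ?_
    gcongr
    have : 0 ≤ 2 / min s₁ 1 := by positivity
    linarith
  · calc ∫⁻ x, ‖Ω.indicator u (x + y) - Ω.indicator u x‖ₑ
        ≤ ∫⁻ x, (‖Ω.indicator u (x + y)‖ₑ + ‖Ω.indicator u x‖ₑ) :=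
          lintegral_mono fun x => enorm_sub_le
      _ = (∫⁻ x, ‖Ω.indicator u (x + y)‖ₑ) + ∫⁻ x, ‖Ω.indicator u x‖ₑ :=
          lintegral_add_right' _ hui.1.enorm
      _ = ENNReal.ofReal 2 * ∫⁻ x in Ω, ‖u x‖ₑ := by
          rw [lintegral_add_right_eq_self (fun x => ‖Ω.indicator u x‖ₑ) y, hW, ← two_mul]
          simp
      _ ≤ _ := by
          gcongr
          · rw [add_mul, div_mul_eq_mul_div]
            have h1 : 2 ≤ 2 * ‖y‖ / min s₁ 1 := by
              rw [le_div_iff₀ hs]; linarith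
            have h2 : 0 ≤ C * ‖y‖ := by positivity
            linarith
          · exact le_self_add

/-! ### The unit cube, the integer lattice and periodicity. -/

/-- The standard basis of `ℝ^N`. -/
noncomputable abbrev stdBasis (N : ℕ) : Module.Basis (Fin N) ℝ (E N) :=
  (EuclideanSpace.basisFun (Fin N) ℝ).toBasis

lemma unitCube_eq_parallelepiped (N : ℕ) :
    unitCube N = parallelepiped (EuclideanSpace.basisFun (Fin N) ℝ) := by
  ext x
  rw [mem_parallelepiped_iff]
  constructor
  · intro hx
    refine ⟨fun i => x i, ⟨fun i => (hx i).1, fun i => (hx i).2⟩, ?_⟩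
    ext j
    simp [Finset.sum_apply, Pi.single_apply]
  · rintro ⟨t, ht, rfl⟩ i
    have : (∑ j, t j • EuclideanSpace.basisFun (Fin N) ℝ j) i = t i := by
      simp [Finset.sum_apply, Pi.single_apply]
    rw [this]
    exact ⟨ht.1 i, ht.2 i⟩

lemma volume_unitCube (N : ℕ) : volume (unitCube N) = 1 := by
  rw [unitCube_eq_parallelepiped]
  exact OrthonormalBasis.volume_parallelepiped _

lemma fundamentalDomain_ae_eq_unitCube (N : ℕ) :
    ZSpan.fundamentalDomain (stdBasis N) =ᵐ[volume] unitCube N := by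
  rw [unitCube_eq_parallelepiped]
  simpa using ZSpan.fundamentalDomain_ae_parallelepiped (stdBasis N) volume

lemma measurableSet_unitCube (N : ℕ) : MeasurableSet (unitCube N) := by
  have : unitCube N = ⋂ i, (fun x : E N => x i) ⁻¹' Icc 0 1 := by
    ext x; simp [unitCube]
  rw [this]
  exact MeasurableSet.iInter fun i => (by fun_prop : Measurable fun x : E N => x i) measurableSet_Icc

lemma norm_le_sqrt_of_mem_unitCube {N : ℕ} {z : E N} (hz : z ∈ unitCube N) : ‖z‖ ≤ √N := by
  rw [EuclideanSpace.norm_eq]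
  refine Real.sqrt_le_sqrt ?_
  calc ∑ i, ‖z i‖ ^ 2 ≤ ∑ _i : Fin N, (1 : ℝ) := by
        refine Finset.sum_le_sum fun i _ => ?_
        rw [Real.norm_eq_abs, sq_abs]
        nlinarith [(hz i).1, (hz i).2]
    _ = N := by simp

/-- The a.e. periods form a subgroup, because translations preserve null sets. -/
lemma IsCubePeriodic.ae_add_eq {N : ℕ} {g : E N → ℝ} (hg : IsCubePeriodic g) {k : E N}
    (hk : k ∈ Submodule.span ℤ (Set.range (stdBasis N))) : ∀ᵐ x, g (x + k) = g x := by
  have shift : ∀ {p : E N → Prop} (a : E N), (∀ᵐ x, p x) → ∀ᵐ x, p (x + a) := fun a h =>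
    (measurePreserving_add_right volume a).quasiMeasurePreserving.ae h
  let H : AddSubgroup (E N) :=
    { carrier := {k | ∀ᵐ x, g (x + k) = g x}
      zero_mem' := by simp
      add_mem' := by
        intro a b ha hb
        filter_upwards [ha, shift a hb] with x h1 h2
        rw [← add_assoc, h2, h1]
      neg_mem' := by
        intro a ha
        filter_upwards [shift (-a) ha] with x h1
        rw [← h1, neg_add_cancel_right] }
  have hle : Submodule.span ℤ (Set.range (stdBasis N)) ≤ AddSubgroup.toIntSubmodule H := by
    rw [Submodule.span_le]
    rintro _ ⟨i, rfl⟩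
    have := hg i
    change ∀ᵐ x, g (x + stdBasis N i) = g x
    simpa using this
  exact hle hk

/-- The lattice is countable, so one null set serves all its vectors, including `-⌊x⌋`, which varies
with `x`. -/
lemma IsCubePeriodic.ae_eq_fract {N : ℕ} {g : E N → ℝ} (hg : IsCubePeriodic g) :
    ∀ᵐ x, g x = g (ZSpan.fract (stdBasis N) x) := by
  have h : ∀ᵐ x, ∀ k : Submodule.span ℤ (Set.range (stdBasis N)), g (x + k) = g x :=
    ae_all_iff.2 fun k => hg.ae_add_eq k.2
  filter_upwards [h] with x hx
  have := hx (-ZSpan.floor (stdBasis N) x)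
  rw [ZSpan.fract_apply, sub_eq_add_neg]
  exact this.symm

/-- The average of a periodic function over any translate of the unit cube is the same. -/
lemma IsCubePeriodic.setIntegral_translate {N : ℕ} {g : E N → ℝ} (hg : IsCubePeriodic g)
    (a : E N) : ∫ z in unitCube N, g (a + z) = cubeMean g := by
  set L := Submodule.span ℤ (Set.range (stdBasis N))
  set F := ZSpan.fundamentalDomain (stdBasis N)
  -- A version of `g` invariant at every point, as comparing integrals over two fundamental domains
  -- requires.
  let g' : E N → ℝ := fun x => g (ZSpan.fract (stdBasis N) x)
  have hper : ∀ (k : L) (x : E N), g' (k +ᵥ x) = g' x := fun k x => by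
    have := ZSpan.fract_zSpan_add (stdBasis N) x k.2
    simp only [g', Submodule.vadd_def, vadd_eq_add, this]
  have hF : IsAddFundamentalDomain L F volume := ZSpan.isAddFundamentalDomain (stdBasis N) volume
  have hcomm : VAddCommClass (E N) L (E N) := ⟨fun a k x => by
    simp only [Submodule.vadd_def, vadd_eq_add]; abel⟩
  have hinv : VAddInvariantMeasure L (E N) volume := ⟨fun k s _ => by
    simpa only [Submodule.vadd_def, vadd_eq_add] using measure_preimage_add volume (k : E N) s⟩
  have hFa : IsAddFundamentalDomain L (a +ᵥ F) volume := hF.vadd_of_comm a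
  have hQF := fundamentalDomain_ae_eq_unitCube N
  calc ∫ z in unitCube N, g (a + z) = ∫ z in F, g (a + z) :=
        setIntegral_congr_set hQF.symm
    _ = ∫ z in F, g' (a + z) := by
        refine integral_congr_ae (ae_restrict_of_ae ?_)
        exact (measurePreserving_add_left volume a).quasiMeasurePreserving.ae hg.ae_eq_fract
    _ = ∫ z in a +ᵥ F, g' z :=
        ((measurePreserving_add_left volume a).setIntegral_image_emb
          (measurableEmbedding_addLeft a) g' F).symm
    _ = ∫ z in F, g' z := hFa.setIntegral_eq hF hper
    _ = ∫ z in F, g z := integral_congr_ae (ae_restrict_of_ae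
        (hg.ae_eq_fract.mono fun x hx => hx.symm))
    _ = cubeMean g := setIntegral_congr_set hQF

/-! ### Oscillating integrals against functions of bounded variation. -/

/-- Integrals of rapidly oscillating periodic functions against a function of bounded variation. -/
lemma IsCubePeriodic.abs_integral_sub_mean_mul_le {N : ℕ} {g : E N → ℝ} (hg : IsCubePeriodic g)
    (hgm : Measurable g) {M : ℝ} (hM : ∀ x, |g x| ≤ M) {f : E N → ℝ} (hf : Integrable f)
    {B : ℝ} (hB : ∀ y, ∫ x, |f (x + y) - f x| ≤ B * ‖y‖) (hB0 : 0 ≤ B) {ε : ℝ} (hε : 0 < ε) :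
    |∫ x, (g (ε⁻¹ • x) - cubeMean g) * f x| ≤ M * B * √N * ε := by
  have hM0 : 0 ≤ M := (abs_nonneg _).trans (hM 0)
  let ν : Measure (E N) := volume.restrict (unitCube N)
  have hν : IsProbabilityMeasure ν := ⟨by simp [ν, volume_unitCube]⟩
  -- Pairing with `g` shifted by `z` in the fast variable; its average over the cube is the mean of
  -- `g` times `∫ f`.
  let J : E N → ℝ := fun z => ∫ x, f x * g (ε⁻¹ • x + z)
  have hint : Integrable (Function.uncurry fun x z => f x * g (ε⁻¹ • x + z))
      ((volume : Measure (E N)).prod ν) := by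
    refine Integrable.mul_bdd (c := M) (hf.comp_fst ν) ?_ (Eventually.of_forall fun p => hM _)
    exact (hgm.comp (by fun_prop)).aestronglyMeasurable
  have hfg : ∀ h : E N → E N, Measurable h → Integrable fun x => f x * g (h x) := fun h hh =>
    Integrable.mul_bdd (c := M) hf (hgm.comp hh).aestronglyMeasurable
      (Eventually.of_forall fun p => hM _)
  have hJ : ∫ z, J z ∂ν = cubeMean g * ∫ x, f x := by
    rw [← integral_integral_swap hint, ← integral_const_mul]
    refine integral_congr_ae (Eventually.of_forall fun x => ?_)
    simp only [integral_const_mul, ν, hg.setIntegral_translate]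
    ring
  have hJi : Integrable J ν := hint.integral_prod_right
  have hI : ∫ x, (g (ε⁻¹ • x) - cubeMean g) * f x
      = ∫ z, ((∫ x, f x * g (ε⁻¹ • x)) - J z) ∂ν := by
    rw [integral_sub (integrable_const _) hJi, hJ, ← integral_const_mul, integral_const,
      probReal_univ, one_smul, ← integral_sub (hfg _ (by fun_prop)) (hf.const_mul _)]
    congr 1; ext x; ring
  have hb : ∀ᵐ z ∂ν, ‖(∫ x, f x * g (ε⁻¹ • x)) - J z‖ ≤ M * B * √N * ε := by
    filter_upwards [ae_restrict_mem (measurableSet_unitCube N)] with z hz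
    -- The substitution `x ↦ x - ε z` moves the shift from `g`, which has no regularity, to `f`.
    have hJz : J z = ∫ x, f (x + -(ε • z)) * g (ε⁻¹ • x) := by
      rw [← integral_add_right_eq_self (fun x => f (x + -(ε • z)) * g (ε⁻¹ • x)) (ε • z)]
      refine integral_congr_ae (Eventually.of_forall fun x => ?_)
      simp [smul_smul, hε.ne']
    have hi : Integrable fun x => f (x + -(ε • z)) := hf.comp_add_right _
    have hi2 : Integrable fun x => f (x + -(ε • z)) * g (ε⁻¹ • x) :=
      Integrable.mul_bdd (c := M) hi (hgm.comp (by fun_prop)).aestronglyMeasurable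
        (Eventually.of_forall fun p => hM _)
    rw [hJz, ← integral_sub (hfg _ (by fun_prop)) hi2]
    calc ‖∫ x, (f x * g (ε⁻¹ • x) - f (x + -(ε • z)) * g (ε⁻¹ • x))‖
        ≤ ∫ x, M * |f (x + -(ε • z)) - f x| := by
          refine norm_integral_le_of_norm_le ((hi.sub hf).abs.const_mul M)
            (Eventually.of_forall fun x => ?_)
          rw [← sub_mul, norm_mul, mul_comm, Real.norm_eq_abs, Real.norm_eq_abs, abs_sub_comm]
          exact mul_le_mul_of_nonneg_right (hM _) (abs_nonneg _)
      _ = M * ∫ x, |f (x + -(ε • z)) - f x| := integral_const_mul _ _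
      _ ≤ M * (B * (ε * √N)) := by
          refine mul_le_mul_of_nonneg_left ((hB _).trans ?_) hM0
          refine mul_le_mul_of_nonneg_left ?_ hB0
          rw [norm_neg, norm_smul, Real.norm_eq_abs, abs_of_pos hε]
          exact mul_le_mul_of_nonneg_left (norm_le_sqrt_of_mem_unitCube hz) hε.le
      _ = _ := by ring
  rw [hI, ← Real.norm_eq_abs]
  simpa using norm_integral_le_of_norm_le_const hb

/-! ### From `L¹` to `L^p`, a bounded representative of `g`, and the theorem. -/

/-- Hölder's inequality on a set of finite measure. -/
lemma lintegral_enorm_le_rpow_integral {N : ℕ} {V : Type*} [NormedAddCommGroup V] {Ω : Set (E N)}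
    {p : ℝ} (hp : 1 ≤ p) {f : E N → V}
    (hf : MemLp f (ENNReal.ofReal p) (volume.restrict Ω)) :
    ∫⁻ x in Ω, ‖f x‖ₑ ≤
      ENNReal.ofReal ((∫ x in Ω, ‖f x‖ ^ p) ^ (1 / p)) * volume Ω ^ (1 - 1 / p) := by
  have hp0 : 0 < p := by linarith
  have h := eLpNorm_le_eLpNorm_mul_rpow_measure_univ (μ := volume.restrict Ω) (p := 1)
    (q := ENNReal.ofReal p) (by simpa using hp) hf.1
  rw [eLpNorm_one_eq_lintegral_enorm, hf.eLpNorm_eq_integral_rpow_norm (by simpa using hp0)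
    ENNReal.ofReal_ne_top, ENNReal.toReal_ofReal hp0.le] at h
  simpa using h

/-- A bounded periodic function agrees a.e. with a measurable one that is bounded everywhere. -/
lemma IsCubePeriodic.exists_measurable_bounded {N : ℕ} {g : E N → ℝ} (hg : IsCubePeriodic g)
    (hb : MemLp g ∞ volume) : ∃ (g' : E N → ℝ) (M : ℝ), g =ᵐ[volume] g' ∧ Measurable g' ∧
      (∀ x, |g' x| ≤ M) ∧ IsCubePeriodic g' := by
  set M := (eLpNorm g ∞ volume).toReal with hMdef
  have hM : 0 ≤ M := ENNReal.toReal_nonneg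
  have hgM : ∀ᵐ x, |g x| ≤ M := by
    have := ae_le_eLpNormEssSup (f := g) (μ := volume)
    filter_upwards [this] with x hx
    rw [← eLpNorm_exponent_top] at hx
    have := ENNReal.toReal_mono hb.2.ne hx
    rw [hMdef]
    simpa using this
  -- Clipping at `±M` changes nothing a.e. and makes the bound hold everywhere.
  let g' : E N → ℝ := fun x => max (min (hb.1.mk g x) M) (-M)
  have hae : g =ᵐ[volume] g' := by
    filter_upwards [hgM, hb.1.ae_eq_mk] with x h1 h2
    simp only [g', ← h2]
    rw [min_eq_left (abs_le.1 h1).2, max_eq_left (abs_le.1 h1).1]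
  refine ⟨g', M, hae, ?_, fun x => abs_le.2 ⟨le_max_right _ _,
    max_le (min_le_right _ _) (by linarith)⟩, fun i => ?_⟩
  · exact (hb.1.stronglyMeasurable_mk.measurable.min measurable_const).max measurable_const
  · have h2 := (measurePreserving_add_right volume
      (EuclideanSpace.single i (1 : ℝ))).quasiMeasurePreserving.ae hae
    filter_upwards [hae, h2, hg i] with x h1 h2 h3
    rw [← h1, ← h2, h3]

end PeriodicHomogenization

open PeriodicHomogenization in
theorem theorem4p3 (N : ℕ) (hN : 1 ≤ N) (p : ℝ) (hp : 1 ≤ p)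
    (Ω : Set (PeriodicHomogenization.E N)) (hΩ_open : IsOpen Ω) (hΩ_conn : IsConnected Ω)
    (hΩ_bdd : Bornology.IsBounded Ω) (hΩ_C1 : PeriodicHomogenization.HasC1Boundary Ω)
    (g : PeriodicHomogenization.E N → ℝ) (hg_bdd : MemLp g ∞ volume)
    (hg_per : PeriodicHomogenization.IsCubePeriodic g) :
    ∃ c : ℝ, ∀ ε : ℝ, 0 < ε → ∀ u : PeriodicHomogenization.E N → ℝ,
      PeriodicHomogenization.MemW1p Ω p u →
        IntegrableOn (fun x => (g (ε⁻¹ • x) - PeriodicHomogenization.cubeMean g) * u x) Ω ∧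
        |∫ x in Ω, (g (ε⁻¹ • x) - PeriodicHomogenization.cubeMean g) * u x|
          ≤ c * ε * PeriodicHomogenization.w1pNorm Ω p u := by
  obtain ⟨g', M, hgg', hg'm, hM, hg'per⟩ := hg_per.exists_measurable_bounded hg_bdd
  obtain ⟨C, hC, hBV⟩ := hΩ_C1.exists_translate_le hΩ_open hΩ_bdd
  have hp0 : 0 < p := by linarith
  have hpi : 0 ≤ 1 / p := by positivity
  have hfin : IsFiniteMeasure (volume.restrict Ω) := ⟨by simpa using hΩ_bdd.measure_lt_top⟩
  set V : ℝ := (volume Ω ^ (1 - 1 / p)).toReal with hV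
  have hVtop : volume Ω ^ (1 - 1 / p) ≠ ⊤ := ENNReal.rpow_ne_top_of_nonneg
    (by rw [sub_nonneg, div_le_one hp0]; exact hp) hΩ_bdd.measure_lt_top.ne
  have hV0 : 0 ≤ V := ENNReal.toReal_nonneg
  have hmean : cubeMean g = cubeMean g' := integral_congr_ae (ae_restrict_of_ae hgg')
  -- Hölder supplies one factor `V` for `u` and one for its gradient; `√N` is the bound for `‖z‖` on
  -- the cube.
  refine ⟨M * (C * (2 * V)) * √N, fun ε hε u hu => ?_⟩
  have hscale : ∀ᵐ x, g (ε⁻¹ • x) = g' (ε⁻¹ • x) :=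
    (Measure.quasiMeasurePreserving_smul (volume : Measure (E N)) (inv_ne_zero hε.ne')).ae hgg'
  obtain ⟨hup, G₀, hG₀, hG₀p⟩ := hu
  have hex : ∃ G, HasWeakGradient Ω u G := ⟨G₀, hG₀⟩
  have hG : HasWeakGradient Ω u (weakGradient Ω u) := by
    rw [weakGradient, dif_pos hex]; exact hex.choose_spec
  -- The chosen gradient need not be the `L^p` one from `MemW1p`; uniqueness a.e. transfers
  -- integrability.
  have hGp : MemLp (weakGradient Ω u) (ENNReal.ofReal p) (volume.restrict Ω) :=
    (memLp_congr_ae (hG.ae_eq hΩ_open hG₀)).2 hG₀p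
  have h1p : 1 ≤ ENNReal.ofReal p := by simpa using hp
  have hui : IntegrableOn u Ω := hup.integrable h1p
  have hGi : IntegrableOn (weakGradient Ω u) Ω := hGp.integrable h1p
  have hu0 : Integrable (Ω.indicator u) := hui.integrable_indicator hΩ_open.measurableSet
  have hcongr : (fun x => (g (ε⁻¹ • x) - cubeMean g) * u x) =ᵐ[volume.restrict Ω]
      fun x => (g' (ε⁻¹ • x) - cubeMean g') * u x := by
    filter_upwards [ae_restrict_of_ae hscale] with x hx
    rw [hx, hmean]
  set w := w1pNorm Ω p u with hw
  have ha : 0 ≤ ∫ x in Ω, |u x| ^ p := integral_nonneg fun x => by positivity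
  have hb : 0 ≤ ∫ x in Ω, ‖weakGradient Ω u x‖ ^ p := integral_nonneg fun x => by positivity
  have hw0 : 0 ≤ w := Real.rpow_nonneg (add_nonneg ha hb) _
  have hW : ∫⁻ x in Ω, ‖u x‖ₑ ≤ ENNReal.ofReal (w * V) := by
    refine (lintegral_enorm_le_rpow_integral hp hup).trans ?_
    rw [ENNReal.ofReal_mul hw0, hV, ENNReal.ofReal_toReal hVtop]
    gcongr
    exact Real.rpow_le_rpow ha (le_add_of_nonneg_right hb) hpi
  have hD : ∫⁻ x in Ω, ‖weakGradient Ω u x‖ₑ ≤ ENNReal.ofReal (w * V) := by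
    refine (lintegral_enorm_le_rpow_integral hp hGp).trans ?_
    rw [ENNReal.ofReal_mul hw0, hV, ENNReal.ofReal_toReal hVtop]
    gcongr
    exact Real.rpow_le_rpow hb (le_add_of_nonneg_left ha) hpi
  have hB : ∀ y, ∫ x, |Ω.indicator u (x + y) - Ω.indicator u x| ≤ C * (2 * V) * w * ‖y‖ := by
    intro y
    rw [← ENNReal.ofReal_le_ofReal_iff (by positivity)]
    have e := ofReal_integral_norm_eq_lintegral_enorm ((hu0.comp_add_right y).sub hu0)
    simp only [Real.norm_eq_abs, Pi.sub_apply] at e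
    rw [e]
    calc _ ≤ _ := hBV u _ hG hui hGi y
      _ ≤ ENNReal.ofReal (C * ‖y‖) * (ENNReal.ofReal (w * V) + ENNReal.ofReal (w * V)) := by
          gcongr
      _ = _ := by
          rw [← ENNReal.ofReal_add (by positivity) (by positivity),
            ← ENNReal.ofReal_mul (by positivity)]
          congr 1; ring
  constructor
  · refine Integrable.congr ?_ hcongr.symm
    refine Integrable.bdd_mul (c := M + |cubeMean g'|) hui ?_ (Filter.Eventually.of_forall fun x => ?_)
    · exact ((hg'm.comp (by fun_prop)).sub_const _).aestronglyMeasurable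
    · exact (norm_sub_le _ _).trans (add_le_add (hM _) le_rfl)
  · have e : ∫ x in Ω, (g (ε⁻¹ • x) - cubeMean g) * u x
        = ∫ x, (g' (ε⁻¹ • x) - cubeMean g') * Ω.indicator u x := by
      rw [integral_congr_ae hcongr, ← integral_indicator hΩ_open.measurableSet]
      refine integral_congr_ae (Filter.Eventually.of_forall fun x => ?_)
      by_cases hx : x ∈ Ω <;> simp [hx]
    rw [e]
    refine (hg'per.abs_integral_sub_mean_mul_le hg'm hM hu0 hB (by positivity) hε).trans
      (le_of_eq ?_)
    ring
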